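/- **Proposition 1 (termination of the restricted Frontal-Delaunay algorithm).** Let $\Sigma\subset\mathbb{R}^3$ be a smooth closed (compact, boundaryless, embedded) surface, let $\bar\rho\ge 1$, and let $\bar h,\bar\epsilon$ be real functions with $\bar h(\mathbf x)\ge\bar h_0>0$ on the convex hull of $\Sigma$ and $\bar\epsilon(\mathbf x)\ge\bar\epsilon_0>0$ on $\Sigma$. Let $X_0\subset\Sigma$ be finite. Then the Frontal-Delaunay algorithm started from $X_0$ terminates after finitely many refinement steps, whatever the order in which facets are refined: there is an $N$ such that no run from $X_0$ has more than $N$ steps, and at every sample reached by a run a further step is impossible if and only if the refinement queue is empty, i.e. every restricted facet $f$ has a largest surface Delaunay ball and satisfies, for every such ball, $\rho(f)<\bar\rho$, $h(f)<\tfrac43\bar h(\mathbf c)$ and $\epsilon(f)<\bar\epsilon(\mathbf c)$, in the notation below. *The algorithm.* For a finite $X\subset\Sigma$, the restricted Delaunay facets are the nondegenerate triangles $f$ with vertices in $X$ whose dual Voronoi edge $\mathbf v_f$ (the intersection of the Voronoi cells of the three vertices) meets $\Sigma$. The largest surface Delaunay ball $B(\mathbf c,r)$ of $f$ is a circumscribing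 ball of $f$, centred on $\mathbf v_f\cap\Sigma$, of maximal radius. Write $\|\mathbf e_0\|$ for the length of the shortest edge of $f$; $\rho(f)=R/\|\mathbf e_0\|$, where $R$ is the circumradius of $f$; $h(f)=\sqrt3\,r$; and $\epsilon(f)$ for the distance from $\mathbf c$ to the circumcentre of $f$. The facet is bad if $\rho(f)\ge\bar\rho$ or $h(f)\ge\tfrac43\bar h(\mathbf c)$ or $\epsilon(f)\ge\bar\epsilon(\mathbf c)$. One step selects a bad restricted facet $f$ and a shortest edge $\mathbf e_0=\mathbf u\mathbf v$ of it, with midpoint $\mathbf m_0$, and adds one Steiner point to $X$, as follows. * The Type I point is $\mathbf c^{(1)}=\mathbf c$. * A candidate for the Type II point is a point $\mathbf p$ that lies on $\Sigma$ and on the face of the Voronoi diagram of $X$ dual to $\mathbf e_0$ (the intersection of the Voronoi cells of $\mathbf u$ and $\mathbf v$, contained in the bisector plane of $\mathbf e_0$) and satisfies $\|\mathbf p-\mathbf m_0\|=a_\sigma$, where $a_\sigma=\min\big((\bar h_\sigma^2-\tfrac14\|\mathbf e_0\|^2)^{1/2},\tfrac{\sqrt3}{2}\bar h_\sigma\big)$,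 $\bar h_\sigma=\tfrac12\big(\bar h(\tfrac{\mathbf u+\mathbf p}{2})+\bar h(\tfrac{\mathbf v+\mathbf p}{2})\big)$ and $\bar h_\sigma\ge\tfrac12\|\mathbf e_0\|$. The Type II point $\mathbf c^{(2)}$ is a candidate that maximises $(\mathbf p-\mathbf m_0)\cdot(\mathbf c-\mathbf m_0)$. * The point $\mathbf c^{(2)}$ is inserted if it exists and $\tfrac12\|\mathbf e_0\|\le\|\mathbf c^{(2)}-\mathbf m_0\|\le\|\mathbf c^{(1)}-\mathbf m_0\|$; otherwise $\mathbf c^{(1)}$ is inserted. Ties between largest balls, shortest edges or best aligned candidates may be broken in any way. -/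

import Mathlib

open scoped ContDiff RealInnerProductSpace

noncomputable section

namespace FrontalDelaunay

/-- Euclidean three-space. -/
abbrev E3 : Type := EuclideanSpace ℝ (Fin 3)

/-- A nondegenerate triangle in Euclidean three-space. -/
abbrev Triangle3 : Type := Affine.Simplex ℝ E3 2

/-- A smooth closed surface embedded in Euclidean three-space: a compact set which is, near each
of its points, the zero set of a smooth real function without critical points. Several connected
components are allowed. -/
structure IsClosedSmoothSurface (S : Set E3) : Prop where
  isCompact : IsCompact S
  exists_local_equation : ∀ p ∈ S, ∃ U : Set E3, IsOpen U ∧ p ∈ U ∧ ∃ F : E3 → ℝ,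
    ContDiffOn ℝ ∞ F U ∧ (∀ x ∈ U, fderiv ℝ F x ≠ 0) ∧ S ∩ U = {x ∈ U | F x = 0}

/-! ### Voronoi diagram and restricted Delaunay triangulation -/

/-- The closed Voronoi cell of the site `p` with respect to the point set `X`. -/
def voronoiCell (X : Set E3) (p : E3) : Set E3 :=
  {x | ∀ q ∈ X, dist x p ≤ dist x q}

/-- The face of the Voronoi diagram of `X` dual to the edge `uv`; it lies in the perpendicular
bisector plane of `uv`. -/
def voronoiFace (X : Set E3) (u v : E3) : Set E3 :=
  voronoiCell X u ∩ voronoiCell X v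

/-- The edge of the Voronoi diagram of `X` dual to the triangle `f`: the centres of the empty
balls that circumscribe `f`. -/
def voronoiEdge (X : Set E3) (f : Triangle3) : Set E3 :=
  ⋂ i, voronoiCell X (f.points i)

/-- `f` is a facet of the Delaunay tessellation of `X` restricted to the surface `S`: its vertices
belong to `X` and its dual Voronoi edge meets `S`. -/
def IsRestrictedFacet (S X : Set E3) (f : Triangle3) : Prop :=
  (∀ i, f.points i ∈ X) ∧ (voronoiEdge X f ∩ S).Nonempty

/-- The radius of the circumscribing ball of `f` centred at `c`. -/
def ballRadius (f : Triangle3) (c : E3) : ℝ := dist c (f.points 0)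

/-- `c` is the centre of a largest surface Delaunay ball of `f`. -/
def IsLargestSurfaceBall (S X : Set E3) (f : Triangle3) (c : E3) : Prop :=
  c ∈ voronoiEdge X f ∩ S ∧ ∀ c' ∈ voronoiEdge X f ∩ S, ballRadius f c' ≤ ballRadius f c

/-! ### Quality measures and the refinement criterion -/

/-- The length of the shortest edge of `f`. -/
def shortestEdge (f : Triangle3) : ℝ :=
  min (dist (f.points 0) (f.points 1))
    (min (dist (f.points 1) (f.points 2)) (dist (f.points 2) (f.points 0)))

/-- The radius-edge ratio: the radius of the diametric ball, whose boundary contains the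
circumcircle of `f` as a great circle, over the length of the shortest edge. -/
def radiusEdgeRatio (f : Triangle3) : ℝ := f.circumradius / shortestEdge f

/-- The element size, where `c` is the centre of the largest surface Delaunay ball of `f`. -/
def elementSize (f : Triangle3) (c : E3) : ℝ := √3 * ballRadius f c

/-- The surface discretisation error: the distance from the centre `c` of the largest surface
Delaunay ball of `f` to the centre of its diametric ball. -/
def surfaceError (f : Triangle3) (c : E3) : ℝ := dist c f.circumcenter

/-- `f`, with largest surface Delaunay ball centred at `c`, violates the shape, the size or the
surface-error threshold; the coefficient `α` of the size threshold is `4 / 3`. -/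
def IsBad (rho : ℝ) (hbar ebar : E3 → ℝ) (f : Triangle3) (c : E3) : Prop :=
  rho ≤ radiusEdgeRatio f ∨ 4 / 3 * hbar c ≤ elementSize f c ∨ ebar c ≤ surfaceError f c

/-! ### Point placement -/

/-- `u` and `v` are the end points of a shortest (frontal) edge of `f`. -/
def IsFrontalEdge (f : Triangle3) (u v : E3) : Prop :=
  ∃ i j, i ≠ j ∧ u = f.points i ∧ v = f.points j ∧ dist u v = shortestEdge f

/-- The target size of the isosceles triangle with base `uv` and apex `p`: the mean of the
mesh-size function at the midpoints of its two legs. -/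
def targetSize (hbar : E3 → ℝ) (u v p : E3) : ℝ :=
  (hbar (midpoint ℝ u p) + hbar (midpoint ℝ v p)) / 2

/-- The target altitude of the isosceles triangle with base `uv` and apex `p`. -/
def targetAltitude (hbar : E3 → ℝ) (u v p : E3) : ℝ :=
  min (√(targetSize hbar u v p ^ 2 - (dist u v / 2) ^ 2)) (√3 / 2 * targetSize hbar u v p)

/-- The candidates for the size-optimal point over the frontal edge `uv`: the intersections `p` of
the surface with the Voronoi face dual to `uv` and with the circle in its plane, about the midpoint
of `uv`, of radius the target altitude. The target size may depend on `p`, and the bound on it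
says that the radicand in the target altitude is not negative. -/
def IsCandidate (S : Set E3) (hbar : E3 → ℝ) (X : Set E3) (u v p : E3) : Prop :=
  p ∈ S ∧ p ∈ voronoiFace X u v ∧ dist u v / 2 ≤ targetSize hbar u v p ∧
    dist p (midpoint ℝ u v) = targetAltitude hbar u v p

/-- `p` is a Type II (size-optimal) point over the frontal edge `uv`: a candidate best aligned
with the frontal direction, from the midpoint of `uv` to the centre `c` of the surface ball. -/
def IsTypeII (S : Set E3) (hbar : E3 → ℝ) (X : Set E3) (u v c p : E3) : Prop :=
  IsCandidate S hbar X u v p ∧ ∀ q, IsCandidate S hbar X u v q →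
    ⟪q - midpoint ℝ u v, c - midpoint ℝ u v⟫ ≤ ⟪p - midpoint ℝ u v, c - midpoint ℝ u v⟫

/-- The criterion under which the Type II point `p` is preferred to the Type I point `c`. -/
def Prefers (u v c p : E3) : Prop :=
  dist p (midpoint ℝ u v) ≤ dist c (midpoint ℝ u v) ∧
    dist u v / 2 ≤ dist p (midpoint ℝ u v)

/-- `s` is the Steiner point inserted for a facet with frontal edge `uv` whose largest surface
Delaunay ball is centred at `c`: the Type II point if there is one and it is preferred, and the
Type I point `c` otherwise. -/
def IsSteinerPoint (S : Set E3) (hbar : E3 → ℝ) (X : Set E3) (u v c s : E3) : Prop :=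
  (∃ p, IsTypeII S hbar X u v c p ∧ ((Prefers u v c p ∧ s = p) ∨ (¬ Prefers u v c p ∧ s = c))) ∨
    ((¬ ∃ p, IsTypeII S hbar X u v c p) ∧ s = c)

/-! ### The algorithm -/

/-- One refinement step: some bad restricted facet is selected and its Steiner point is inserted.
The order of refinement, and the choice between equally large balls, equally short edges and
equally aligned candidates, are left free. -/
def Step (S : Set E3) (rho : ℝ) (hbar ebar : E3 → ℝ) (X X' : Set E3) : Prop :=
  ∃ f c u v s, IsRestrictedFacet S X f ∧ IsLargestSurfaceBall S X f c ∧ IsBad rho hbar ebar f c ∧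
    IsFrontalEdge f u v ∧ IsSteinerPoint S hbar X u v c s ∧ X' = insert s X

/-- The sequence `run` performs `n` refinement steps, starting from the sample `X₀`. -/
def IsRun (S : Set E3) (rho : ℝ) (hbar ebar : E3 → ℝ) (X₀ : Set E3) (n : ℕ) (run : ℕ → Set E3) :
    Prop :=
  run 0 = X₀ ∧ ∀ k < n, Step S rho hbar ebar (run k) (run (k + 1))

/-- The refinement queue of the sample `X` is empty: every restricted facet has a largest surface
Delaunay ball, and meets all three thresholds. -/
def QueueEmpty (S : Set E3) (rho : ℝ) (hbar ebar : E3 → ℝ) (X : Set E3) : Prop :=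
  ∀ f, IsRestrictedFacet S X f → (∃ c, IsLargestSurfaceBall S X f c) ∧
    ∀ c, IsLargestSurfaceBall S X f c →
      radiusEdgeRatio f < rho ∧ elementSize f c < 4 / 3 * hbar c ∧ surfaceError f c < ebar c

end FrontalDelaunay

end

namespace FrontalDelaunay

variable {S X X' : Set E3} {f : Triangle3} {c u v p : E3} {rho h₀ e₀ δ : ℝ} {hbar ebar : E3 → ℝ}

/-! A packing argument. Let `δ` be the minimum of the separation of `X₀`, `h₀ / 2` and `e₀`. Every
inserted point is at distance at least `δ` from the current sample, and a compact surface holds only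
boundedly many `δ`-separated points (`exists_ncard_le_of_separated`).

A Type I point is the centre of an empty ball whose radius satisfies `r² = R² + ε²`
(`ballRadius_sq`), so each of the three ways of being bad forces `r ≥ δ` (`le_ballRadius_of_isBad`).
A Type II point `p` has `u` as a nearest sample point, and the prescribed altitude keeps `dist p u ≥
h₀ / 2` (`IsCandidate.half_le_dist`). -/

/-- In a totally bounded set, the cardinality of `δ`-separated finite subsets is bounded. -/
theorem exists_ncard_le_of_separated {α : Type*} [PseudoMetricSpace α] {S : Set α}
    (hS : TotallyBounded S) {δ : ℝ} (hδ : 0 < δ) :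
    ∃ N : ℕ, ∀ X ⊆ S, (∀ x ∈ X, ∀ y ∈ X, x ≠ y → δ ≤ dist x y) → X.ncard ≤ N := by
  obtain ⟨t, ht, hcover⟩ := Metric.totallyBounded_iff.1 hS (δ / 2) (half_pos hδ)
  refine ⟨t.ncard, fun X hXS hX => ?_⟩
  have hnear : ∀ x ∈ X, ∃ y ∈ t, dist x y < δ / 2 := fun x hx => by
    simpa using hcover (hXS hx)
  choose! g hgt hg using hnear
  -- Two points assigned to the same centre would be less than `δ` apart.
  refine Set.ncard_le_ncard_of_injOn g hgt (fun x hx y hy hxy => ?_) ht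
  by_contra hne
  have h₁ := hX x hx y hy hne
  have h₂ := dist_triangle_right x y (g x)
  have h₃ := hg x hx
  have h₄ := hg y hy
  rw [← hxy] at h₄
  linarith

/-- A finite set in a metric space is uniformly separated. -/
theorem exists_separation {α : Type*} [MetricSpace α] {X : Set α} (hX : X.Finite) :
    ∃ δ : ℝ, 0 < δ ∧ ∀ x ∈ X, ∀ y ∈ X, x ≠ y → δ ≤ dist x y := by
  by_cases hne : X.offDiag.Nonempty
  · obtain ⟨q, hq, hmin⟩ := Set.exists_min_image X.offDiag (fun q => dist q.1 q.2)
      hX.offDiag hne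
    exact ⟨dist q.1 q.2, dist_pos.2 hq.2.2, fun x hx y hy hxy => hmin (x, y) ⟨hx, hy, hxy⟩⟩
  · refine ⟨1, one_pos, fun x hx y hy hxy => (hne ⟨(x, y), hx, hy, hxy⟩).elim⟩

theorem isClosed_voronoiCell (X : Set E3) (p : E3) : IsClosed (voronoiCell X p) := by
  simp only [voronoiCell, Set.ofPred_forall]
  exact isClosed_iInter fun q => isClosed_iInter fun _ =>
    isClosed_le (by fun_prop) (by fun_prop)

theorem isClosed_voronoiEdge (X : Set E3) (f : Triangle3) : IsClosed (voronoiEdge X f) :=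
  isClosed_iInter fun _ => isClosed_voronoiCell X _

theorem dist_eq_of_mem_voronoiFace (hu : u ∈ X) (hv : v ∈ X) (hp : p ∈ voronoiFace X u v) :
    dist p u = dist p v :=
  le_antisymm (hp.1 v hv) (hp.2 u hu)

/-- Surface Delaunay balls are empty: their interiors contain no sample point. -/
theorem ballRadius_le_dist (hc : c ∈ voronoiEdge X f) {q : E3} (hq : q ∈ X) :
    ballRadius f c ≤ dist c q :=
  Set.mem_iInter.1 hc 0 q hq

theorem dist_eq_ballRadius (hf : ∀ i, f.points i ∈ X) (hc : c ∈ voronoiEdge X f) (i : Fin 3) :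
    dist c (f.points i) = ballRadius f c :=
  le_antisymm (Set.mem_iInter.1 hc i _ (hf 0)) (ballRadius_le_dist hc (hf i))

/-- Pythagoras for the radii of a circumscribing ball and of the diametric ball of a triangle. -/
theorem ballRadius_sq (hf : ∀ i, f.points i ∈ X) (hc : c ∈ voronoiEdge X f) :
    ballRadius f c ^ 2 = f.circumradius ^ 2 + surfaceError f c ^ 2 := by
  have hr : ∀ i, dist (f.points i) c = ballRadius f c := fun i => by
    rw [dist_comm, dist_eq_ballRadius hf hc]
  have h := f.dist_circumcenter_sq_eq_sq_sub_circumradius hr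
    (f.orthogonalProjection_eq_circumcenter_of_dist_eq hr)
    (mem_affineSpan ℝ (Set.mem_range_self 0))
  rw [surfaceError]
  linarith

theorem exists_isFrontalEdge (f : Triangle3) : ∃ u v, IsFrontalEdge f u v := by
  have key : ∃ i j : Fin 3, i ≠ j ∧ dist (f.points i) (f.points j) = shortestEdge f := by
    unfold shortestEdge
    rcases min_choice (dist (f.points 0) (f.points 1))
      (min (dist (f.points 1) (f.points 2)) (dist (f.points 2) (f.points 0))) with h | h
    · exact ⟨0, 1, by decide, h.symm⟩
    · rw [h]
      rcases min_choice (dist (f.points 1) (f.points 2)) (dist (f.points 2) (f.points 0))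
        with h | h
      · exact ⟨1, 2, by decide, h.symm⟩
      · exact ⟨2, 0, by decide, h.symm⟩
  obtain ⟨i, j, hij, h⟩ := key
  exact ⟨_, _, i, j, hij, rfl, rfl, h⟩

/-- A best aligned candidate may fail to exist, as `hbar` need not be continuous; the Type I point
is then the fallback. -/
theorem exists_isSteinerPoint (S : Set E3) (hbar : E3 → ℝ) (X : Set E3) (u v c : E3) :
    ∃ s, IsSteinerPoint S hbar X u v c s := by
  by_cases h : ∃ p, IsTypeII S hbar X u v c p
  · obtain ⟨p, hp⟩ := h
    by_cases hpref : Prefers u v c p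
    · exact ⟨p, .inl ⟨p, hp, .inl ⟨hpref, rfl⟩⟩⟩
    · exact ⟨c, .inl ⟨p, hp, .inr ⟨hpref, rfl⟩⟩⟩
  · exact ⟨c, .inr ⟨h, rfl⟩⟩

theorem IsRestrictedFacet.exists_isLargestSurfaceBall (hS : IsCompact S)
    (hf : IsRestrictedFacet S X f) : ∃ c, IsLargestSurfaceBall S X f c := by
  obtain ⟨c, hc, hmax⟩ := (hS.inter_left (isClosed_voronoiEdge X f)).exists_isMaxOn hf.2
    (f := ballRadius f) (by unfold ballRadius; fun_prop)
  exact ⟨c, hc, fun c' hc' => hmax hc'⟩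

theorem shortestEdge_pos (f : Triangle3) : 0 < shortestEdge f := by
  obtain ⟨u, v, i, j, hij, rfl, rfl, h⟩ := exists_isFrontalEdge f
  rw [← h]
  exact dist_pos.2 (f.independent.injective.ne hij)

/-- A surface ball of a bad facet has a radius bounded below by the separation of the sample and
the lower bounds on the size and error thresholds. -/
theorem le_ballRadius_of_isBad (hrho : 1 ≤ rho) (hX : ∀ x ∈ X, ∀ y ∈ X, x ≠ y → δ ≤ dist x y)
    (hh : δ ≤ h₀ / 2) (hh₀ : 0 < h₀) (he : δ ≤ e₀) (he₀ : 0 < e₀)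
    (hf : ∀ i, f.points i ∈ X) (hc : c ∈ voronoiEdge X f)
    (hhc : h₀ ≤ hbar c) (hec : e₀ ≤ ebar c) (hbad : IsBad rho hbar ebar f c) :
    δ ≤ ballRadius f c := by
  have hr : 0 ≤ ballRadius f c := dist_nonneg
  have hsq := ballRadius_sq hf hc
  rcases hbad with h | h | h
  · obtain ⟨u, v, i, j, hij, rfl, rfl, hedge⟩ := exists_isFrontalEdge f
    have hpos := shortestEdge_pos f
    have hδ := hX _ (hf i) _ (hf j) (f.independent.injective.ne hij)
    -- Here `1 ≤ rho` is essential: the radius is at least an existing edge length, so the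
    -- separation does not shrink.
    have h₁ : 1 * shortestEdge f ≤ f.circumradius := (le_div_iff₀ hpos).1 (hrho.trans h)
    have h₂ : f.circumradius ≤ ballRadius f c :=
      le_of_abs_le (abs_le_of_sq_le_sq (by nlinarith [sq_nonneg (surfaceError f c)]) hr)
    linarith
  -- This crude bound suffices: `2 * r ≥ √3 * r ≥ 4 / 3 * h₀`.
  · have h₁ : √3 ≤ 2 := by rw [Real.sqrt_le_left (by norm_num)]; norm_num
    unfold elementSize at h
    nlinarith
  · refine he.trans (le_of_abs_le (abs_le_of_sq_le_sq ?_ hr))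
    nlinarith [sq_nonneg f.circumradius]

/-- The legs' midpoints generally leave the surface, hence the bound on the convex hull. -/
theorem le_targetSize (hhbar : ∀ x ∈ convexHull ℝ S, h₀ ≤ hbar x) (hu : u ∈ S) (hv : v ∈ S)
    (hp : p ∈ S) : h₀ ≤ targetSize hbar u v p := by
  have hmid : ∀ w ∈ S, midpoint ℝ w p ∈ convexHull ℝ S := fun w hw =>
    (convex_convexHull ℝ S).midpoint_mem (subset_convexHull ℝ S hw) (subset_convexHull ℝ S hp)
  have h₁ := hhbar _ (hmid u hu)
  have h₂ := hhbar _ (hmid v hv)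
  unfold targetSize
  linarith

/-- Size-optimal points keep a distance to the sample that is bounded below by the mesh size. -/
theorem IsCandidate.half_le_dist (hhbar : ∀ x ∈ convexHull ℝ S, h₀ ≤ hbar x) (hh₀ : 0 < h₀)
    (hXS : X ⊆ S) (hu : u ∈ X) (hv : v ∈ X) (hp : IsCandidate S hbar X u v p) {q : E3}
    (hq : q ∈ X) : h₀ / 2 ≤ dist p q := by
  obtain ⟨hpS, hface, hle, halt⟩ := hp
  refine le_trans ?_ (hface.1 q hq)
  have hsize := le_targetSize hhbar (hXS hu) (hXS hv) hpS
  have heq := dist_eq_of_mem_voronoiFace hu hv hface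
  have hpyth : dist p u ^ 2 = dist p (midpoint ℝ u v) ^ 2 + (dist u v / 2) ^ 2 := by
    have h := EuclideanGeometry.dist_sq_add_dist_sq_eq_two_mul_dist_midpoint_sq_add_half_dist_sq
      p u v
    rw [← heq] at h
    linarith
  set t := targetSize hbar u v p
  have hd : 0 ≤ dist u v := dist_nonneg
  refine le_of_abs_le (abs_le_of_sq_le_sq ?_ dist_nonneg)
  rw [hpyth, halt, targetAltitude]
  -- The squared distance is `t ^ 2` in the first case and at least `3 / 4 * t ^ 2` in the second.
  rcases min_choice √(t ^ 2 - (dist u v / 2) ^ 2) (√3 / 2 * t) with h | h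
  · rw [h, Real.sq_sqrt (by nlinarith)]
    nlinarith
  · rw [h, mul_pow, div_pow √3, Real.sq_sqrt (by norm_num)]
    nlinarith [sq_nonneg (dist u v / 2)]

/-- A refinement step inserts a surface point that is far from all sample points. -/
theorem Step.exists_insert (hrho : 1 ≤ rho) (hh₀ : 0 < h₀) (he₀ : 0 < e₀)
    (hhbar : ∀ x ∈ convexHull ℝ S, h₀ ≤ hbar x) (hebar : ∀ x ∈ S, e₀ ≤ ebar x)
    (hh : δ ≤ h₀ / 2) (he : δ ≤ e₀) (hXS : X ⊆ S)
    (hX : ∀ x ∈ X, ∀ y ∈ X, x ≠ y → δ ≤ dist x y) (hstep : Step S rho hbar ebar X X') :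
    ∃ s ∈ S, (∀ q ∈ X, δ ≤ dist s q) ∧ X' = insert s X := by
  obtain ⟨f, c, u, v, s, ⟨hf, -⟩, ⟨⟨hc, hcS⟩, -⟩, hbad, ⟨i, j, -, rfl, rfl, -⟩, hs, rfl⟩ := hstep
  have htypeI : ∀ q ∈ X, δ ≤ dist c q := fun q hq =>
    (le_ballRadius_of_isBad hrho hX hh hh₀ he he₀ hf hc (hhbar c (subset_convexHull ℝ S hcS))
      (hebar c hcS) hbad).trans (ballRadius_le_dist hc hq)
  rcases hs with ⟨p, hp, ⟨-, rfl⟩ | ⟨-, rfl⟩⟩ | ⟨-, rfl⟩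
  · exact ⟨s, hp.1.1, fun q hq =>
      hh.trans (hp.1.half_le_dist hhbar hh₀ hXS (hf i) (hf j) hq), rfl⟩
  · exact ⟨s, hcS, htypeI, rfl⟩
  · exact ⟨s, hcS, htypeI, rfl⟩

/-- Along a run the sample stays on the surface and uniformly separated, and it gains a point
with every step. -/
theorem IsRun.separated {X₀ : Set E3} {n : ℕ} {run : ℕ → Set E3}
    (hrho : 1 ≤ rho) (hh₀ : 0 < h₀) (he₀ : 0 < e₀)
    (hhbar : ∀ x ∈ convexHull ℝ S, h₀ ≤ hbar x) (hebar : ∀ x ∈ S, e₀ ≤ ebar x)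
    (hδ : 0 < δ) (hh : δ ≤ h₀ / 2) (he : δ ≤ e₀) (hX₀ : X₀.Finite) (hX₀S : X₀ ⊆ S)
    (hsep : ∀ x ∈ X₀, ∀ y ∈ X₀, x ≠ y → δ ≤ dist x y)
    (hrun : IsRun S rho hbar ebar X₀ n run) : ∀ k ≤ n, (run k).Finite ∧ run k ⊆ S ∧
      (∀ x ∈ run k, ∀ y ∈ run k, x ≠ y → δ ≤ dist x y) ∧ k ≤ (run k).ncard := by
  intro k
  induction k with
  | zero => intro _; rw [hrun.1]; exact ⟨hX₀, hX₀S, hsep, Nat.zero_le _⟩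
  | succ k ih =>
    intro hk
    obtain ⟨hfin, hkS, hksep, hcard⟩ := ih (by omega)
    obtain ⟨s, hsS, hs, heq⟩ :=
      (hrun.2 k (by omega)).exists_insert hrho hh₀ he₀ hhbar hebar hh he hkS hksep
    have hnot : s ∉ run k := fun hmem => by
      have := hs s hmem
      rw [dist_self] at this
      linarith
    rw [heq]
    refine ⟨hfin.insert s, Set.insert_subset hsS hkS, ?_, ?_⟩
    · rintro x (rfl | hx) y (rfl | hy) hxy
      · exact (hxy rfl).elim
      · exact hs y hy
      · rw [dist_comm]
        exact hs x hx
      · exact hksep x hx y hy hxy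
    · rw [Set.ncard_insert_of_notMem hnot hfin]
      omega

/-- A bad facet never blocks the algorithm: compactness provides a largest ball, and an edge and a
Steiner point can always be chosen. -/
theorem not_exists_step_iff_queueEmpty (hS : IsCompact S) (rho : ℝ) (hbar ebar : E3 → ℝ)
    (X : Set E3) : (¬ ∃ X', Step S rho hbar ebar X X') ↔ QueueEmpty S rho hbar ebar X := by
  constructor
  · intro h f hf
    refine ⟨hf.exists_isLargestSurfaceBall hS, fun c hc => ?_⟩
    have hgood : ¬ IsBad rho hbar ebar f c := fun hbad => by
      obtain ⟨u, v, huv⟩ := exists_isFrontalEdge f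
      obtain ⟨s, hs⟩ := exists_isSteinerPoint S hbar X u v c
      exact h ⟨_, f, c, u, v, s, hf, hc, hbad, huv, hs, rfl⟩
    simpa [IsBad] using hgood
  · rintro h ⟨X', f, c, u, v, s, hf, hc, hbad, -⟩
    obtain ⟨h₁, h₂, h₃⟩ := (h f hf).2 c hc
    rcases hbad with hb | hb | hb
    · exact hb.not_gt h₁
    · exact hb.not_gt h₂
    · exact hb.not_gt h₃

end FrontalDelaunay

theorem proposition1
    (S : Set FrontalDelaunay.E3) (hS : FrontalDelaunay.IsClosedSmoothSurface S)
    (rho : ℝ) (hrho : 1 ≤ rho)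
    (hbar ebar : FrontalDelaunay.E3 → ℝ)
    (h₀ e₀ : ℝ) (hh₀ : 0 < h₀) (he₀ : 0 < e₀)
    (hhbar : ∀ x ∈ convexHull ℝ S, h₀ ≤ hbar x) (hebar : ∀ x ∈ S, e₀ ≤ ebar x)
    (X₀ : Set FrontalDelaunay.E3) (hX₀ : X₀.Finite) (hX₀S : X₀ ⊆ S) :
    (∃ N : ℕ, ∀ (n : ℕ) (run : ℕ → Set FrontalDelaunay.E3),
      FrontalDelaunay.IsRun S rho hbar ebar X₀ n run → n ≤ N) ∧
    (∀ (n : ℕ) (run : ℕ → Set FrontalDelaunay.E3),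
      FrontalDelaunay.IsRun S rho hbar ebar X₀ n run →
        ((¬ ∃ X', FrontalDelaunay.Step S rho hbar ebar (run n) X') ↔
          FrontalDelaunay.QueueEmpty S rho hbar ebar (run n))) := by
  refine ⟨?_, fun n run _ =>
    FrontalDelaunay.not_exists_step_iff_queueEmpty hS.isCompact rho hbar ebar (run n)⟩
  obtain ⟨δ₀, hδ₀, hsep⟩ := FrontalDelaunay.exists_separation hX₀
  obtain ⟨δ, hδ, hδle⟩ : ∃ δ, 0 < δ ∧ δ ≤ δ₀ ∧ δ ≤ h₀ / 2 ∧ δ ≤ e₀ :=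
    ⟨min δ₀ (min (h₀ / 2) e₀), by positivity, by simp⟩
  obtain ⟨N, hN⟩ :=
    FrontalDelaunay.exists_ncard_le_of_separated hS.isCompact.totallyBounded hδ
  refine ⟨N, fun n run hrun => ?_⟩
  obtain ⟨-, hsub, hsepn, hcard⟩ := hrun.separated hrho hh₀ he₀ hhbar hebar hδ hδle.2.1 hδle.2.2
    hX₀ hX₀S (fun x hx y hy hxy => hδle.1.trans (hsep x hx y hy hxy)) n le_rfl
  exact hcard.trans (hN _ hsub hsepn)
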